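/- For a finite simple graph $G$ with $n$ vertices, let $\lambda_1(G)\ge\lambda_2(G)\ge\cdots\ge\lambda_n(G)$ be the eigenvalues of its adjacency matrix, counted with multiplicity, and let $\|G\|_*$ denote the trace norm of $G$, that is, the sum of the singular values of its adjacency matrix. A graph is called $r$-partite if its vertices can be partitioned into $r$ sets (some of which may be empty), none of which contains an edge. **Theorem.** Let $n>r>2$ and $m$ be integers with $2m\ge r^2n$. If $G$ is an $r$-partite graph with $n$ vertices and $m$ edges, then $$\|G\|_*\le \frac{4m}{n}+\sqrt{(n-r)\left(2m-\frac{r}{r-1}\left(\frac{2m}{n}\right)^2\right)}.$$ Equality holds if and only if the following three conditions are met: (i) $G$ is a regular graph; (ii) the $r-1$ smallest eigenvalues of $G$ satisfy $$\lambda_n(G)=\cdots=\lambda_{n-r+2}(G)=-\frac{2m}{(r-1)n};$$ (iii) the eigenvalues $\lambda_2(G),\ldots,\lambda_{n-r+1}(G)$ satisfy $$\lambda_2^2(G)=\cdots=\lambda_{n-r+1}^2(G)=\frac{1}{n-r}\left(2m-\frac{r}{r-1}\left(\frac{2m}{n}\right)^2\right).$$ -/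

import Mathlib

/-- The trace norm `‖A‖_*` of a real or complex matrix: the sum of its singular values. The column
space `EuclideanSpace 𝕜 n` has dimension `Fintype.card n`; the singular values, counted with
multiplicity, are those with index below this dimension (Mathlib extends the sequence by zeros). -/
noncomputable def Matrix.traceNorm {𝕜 m n : Type*} [RCLike 𝕜] [Fintype m] [Fintype n]
    [DecidableEq n] (A : Matrix m n 𝕜) : ℝ :=
  ∑ i ∈ Finset.range (Fintype.card n), (Matrix.toEuclideanLin A).singularValues i

namespace SimpleGraph

/-- The trace norm `‖G‖_*` of a finite graph: the trace norm of its adjacency matrix. -/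
noncomputable def traceNorm {V : Type*} [Fintype V] [DecidableEq V] (G : SimpleGraph V)
    [DecidableRel G.Adj] : ℝ :=
  (G.adjMatrix ℝ).traceNorm

/-- `G.adjEigenvalue i` is `λ_i(G)`, the `i`-th largest eigenvalue (with multiplicity) of the
adjacency matrix of `G`, for `1 ≤ i ≤ n` where `n` is the number of vertices. The index starts
at `1`, so `i` is shifted by one against Mathlib's decreasing enumeration; outside of `1 ≤ i ≤ n`
the value is `0` by convention. -/
noncomputable def adjEigenvalue {V : Type*} [Fintype V] [DecidableEq V] (G : SimpleGraph V)
    [DecidableRel G.Adj] (i : ℕ) : ℝ :=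
  if h : 1 ≤ i ∧ i ≤ Fintype.card V then
    (G.isHermitian_adjMatrix ℝ).eigenvalues₀ ⟨i - 1, by omega⟩
  else 0

end SimpleGraph

open scoped InnerProductSpace

/-! Put `a = 2m/n`. The squares of the eigenvalues sum to `2m`, and `λ₁ ≥ a` by the Rayleigh
quotient of the all-ones vector (`average_degree_le_adjEigenvalue_one`). Hoffman's inequality
(`sum_smallest_adjEigenvalue_le`) forces the `r - 1` smallest eigenvalues to have absolute sum at
least `λ₁`. The rest is an optimisation (`l1_le_and_eq_iff_of_sum_sq`). Cauchy–Schwarz bounds the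
middle block by the squares left for it. Pushing `λ₁` or the last block above `a` uses up squares,
and the middle block then loses more than is gained, because `2m ≥ r²n`. This comparison is strict,
which gives the equality case. -/

/-! ### The optimisation under a quadratic constraint -/

set_option maxHeartbeats 1000000 in
/-- An optimisation under a quadratic constraint: if `x ≥ a`, the entries of `f` on `L` sum to at
most `-x`, and the total sum of squares is `T`, then the `ℓ¹`-norm is at most its value at
`x = a`, `f = -a / K` on `L`, and `|f|` constant on `M`. -/
theorem l1_le_and_eq_iff_of_sum_sq {ι : Type*} {M L : Finset ι} {f : ι → ℝ} {x a N K T : ℝ}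
    (hM : (M.card : ℝ) = N) (hL : (L.card : ℝ) = K) (hN : 0 < N) (hK : 1 ≤ K) (ha : 0 < a)
    (hx : a ≤ x) (hLx : ∑ i ∈ L, f i ≤ -x)
    (hT : x ^ 2 + ∑ i ∈ M, f i ^ 2 + ∑ i ∈ L, f i ^ 2 = T)
    (hlt : K ^ 2 * (T - (K + 1) / K * a ^ 2) < N * a ^ 2) :
    (|x| + ∑ i ∈ M, |f i| + ∑ i ∈ L, |f i| ≤ 2 * a + √(N * (T - (K + 1) / K * a ^ 2))) ∧
    (|x| + ∑ i ∈ M, |f i| + ∑ i ∈ L, |f i| = 2 * a + √(N * (T - (K + 1) / K * a ^ 2)) →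
      x = a) ∧
    (|x| + ∑ i ∈ M, |f i| + ∑ i ∈ L, |f i| = 2 * a + √(N * (T - (K + 1) / K * a ^ 2)) ↔
      (∀ i ∈ L, f i = -(a / K)) ∧
      (∀ i ∈ M, f i ^ 2 = 1 / N * (T - (K + 1) / K * a ^ 2))) := by
  have hK0 : 0 < K := by linarith
  have hDeq : (K + 1) / K * a ^ 2 = a ^ 2 + a ^ 2 / K := by field_simp
  rw [hDeq] at hlt ⊢
  set D := T - (a ^ 2 + a ^ 2 / K) with hD
  set S := ∑ i ∈ L, |f i| with hS
  set p := ∑ i ∈ M, |f i| with hp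
  set P := ∑ i ∈ M, f i ^ 2 with hP
  set Q := ∑ i ∈ L, f i ^ 2 with hQ
  have hx0 : 0 < x := ha.trans_le hx
  rw [abs_of_pos hx0]
  have hSx : x ≤ S := by
    have : -S ≤ ∑ i ∈ L, f i := by
      rw [hS, ← Finset.sum_neg_distrib]
      exact Finset.sum_le_sum fun i _ => neg_abs_le _
    linarith
  have hpP : p ^ 2 ≤ N * P := by
    have := sq_sum_le_card_mul_sum_sq (s := M) (f := fun i => |f i|)
    simpa [hM] using this
  have hSQ : S ^ 2 ≤ K * Q := by
    have := sq_sum_le_card_mul_sum_sq (s := L) (f := fun i => |f i|)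
    simpa [hL] using this
  have hP0 : 0 ≤ P := Finset.sum_nonneg fun i _ => sq_nonneg _
  have hp0 : 0 ≤ p := Finset.sum_nonneg fun i _ => abs_nonneg _
  have hQ' : S ^ 2 / K ≤ Q := by rw [div_le_iff₀ hK0]; linarith
  -- Tangent lines at `a`: `S² / K` has slope `2a / K`, and `x²` has slope `2a`, lowered to `2a / K`
  -- since `K ≥ 1`.
  have hDP : 2 * a / K * ((x - a) + (S - a)) ≤ D - P := by
    have h1 : 2 * a / K * (x - a) ≤ x ^ 2 - a ^ 2 := by
      have : 2 * a / K ≤ 2 * a := div_le_self (by linarith) hK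
      nlinarith [mul_le_mul_of_nonneg_right this (sub_nonneg.2 hx), sq_nonneg (x - a)]
    have h2 : 2 * a / K * (S - a) ≤ S ^ 2 / K - a ^ 2 / K := by
      rw [← sub_div, div_mul_eq_mul_div]
      exact div_le_div_of_nonneg_right (by nlinarith [sq_nonneg (S - a)]) hK0.le
    rw [hD, ← hT]; linarith
  have hE0 : 0 ≤ (x - a) + (S - a) := by linarith
  have hPD : P ≤ D := by
    have : 0 ≤ 2 * a / K * ((x - a) + (S - a)) := by positivity
    linarith
  have hD0 : 0 ≤ D := hP0.trans hPD
  set q := √D with hq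
  set y := √P with hy
  set s := √N with hs
  have hq2 : q ^ 2 = D := Real.sq_sqrt hD0
  have hy2 : y ^ 2 = P := Real.sq_sqrt hP0
  have hs2 : s ^ 2 = N := Real.sq_sqrt hN.le
  have hq0 : 0 ≤ q := Real.sqrt_nonneg _
  have hy0 : 0 ≤ y := Real.sqrt_nonneg _
  have hs0 : 0 ≤ s := Real.sqrt_nonneg _
  have hyq : y ≤ q := Real.sqrt_le_sqrt hPD
  have hsq : √(N * D) = s * q := Real.sqrt_mul hN.le _
  have hps : p ≤ s * y := by
    apply le_of_sq_le_sq _ (by positivity)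
    rw [mul_pow, hs2, hy2]; exact hpP
  have hKq : K * q < s * a := by
    apply lt_of_pow_lt_pow_left₀ 2 (by positivity)
    rw [mul_pow, mul_pow, hq2, hs2]; exact hlt
  have hEq : a * ((x - a) + (S - a)) ≤ K * q * (q - y) := by
    have h1 : 2 * a * ((x - a) + (S - a)) ≤ K * ((q - y) * (q + y)) := by
      have : (q - y) * (q + y) = D - P := by rw [← hq2, ← hy2]; ring
      rw [this, ← div_le_iff₀' hK0]
      calc _ = 2 * a / K * ((x - a) + (S - a)) := by ring
        _ ≤ _ := hDP
    have h2 : (q - y) * (q + y) ≤ (q - y) * (2 * q) :=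
      mul_le_mul_of_nonneg_left (by linarith) (by linarith)
    nlinarith [mul_le_mul_of_nonneg_left h2 hK0.le]
  have hE : (x - a) + (S - a) ≤ s * (q - y) := by
    have : K * q * (q - y) ≤ s * a * (q - y) :=
      mul_le_mul_of_nonneg_right hKq.le (by linarith)
    refine le_of_mul_le_mul_left ?_ ha
    linarith
  rw [hsq]
  -- If `y < q`, the strict `hKq` contradicts `hEq`; so `q = y` and the excess over `a` vanishes.
  have key : x + p + S = 2 * a + s * q → x = a ∧ S = a ∧ P = D ∧ p ^ 2 = N * P := by
    intro h
    have hE' : (x - a) + (S - a) = s * (q - y) := by linarith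
    have hp' : p = s * y := by linarith
    have hqy : q = y := by
      by_contra hne
      have hlt' : 0 < q - y := sub_pos.2 (lt_of_le_of_ne hyq (Ne.symm hne))
      have := mul_lt_mul_of_pos_right hKq hlt'
      rw [hE'] at hEq
      linarith
    have h0 : (x - a) + (S - a) = 0 := by rw [hE', hqy]; ring
    refine ⟨by linarith, by linarith, by rw [← hq2, ← hy2, hqy], ?_⟩
    rw [hp', mul_pow, hs2, hy2]
  refine ⟨by linarith, fun h => (key h).1, fun h => ?_, fun ⟨h1, h2⟩ => ?_⟩
  · obtain ⟨hxa, hSa, hPD', hpN⟩ := key h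
    constructor
    · have hsum : ∑ i ∈ L, (f i + a / K) ^ 2 = Q + 2 * (a / K) * ∑ i ∈ L, f i + a ^ 2 / K := by
        simp_rw [add_sq, Finset.sum_add_distrib, Finset.sum_const, nsmul_eq_mul, hL, hQ,
          Finset.mul_sum]
        congr 1
        · congr 1
          exact Finset.sum_congr rfl fun i _ => by ring
        · field_simp
      have hQa : Q = a ^ 2 / K := by
        rw [hPD', hD, hxa] at hT; linarith
      have hle : ∑ i ∈ L, (f i + a / K) ^ 2 ≤ 0 := by
        have h3 : 2 * (a / K) * ∑ i ∈ L, f i ≤ 2 * (a / K) * (-a) :=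
          mul_le_mul_of_nonneg_left (by linarith) (by positivity)
        have h4 : 2 * (a / K) * (-a) = -(2 * (a ^ 2 / K)) := by ring
        linarith
      have h0 := (Finset.sum_eq_zero_iff_of_nonneg fun i _ => sq_nonneg (f i + a / K)).1
        (le_antisymm hle (Finset.sum_nonneg fun i _ => sq_nonneg _))
      intro i hi
      have := pow_eq_zero_iff (two_ne_zero) |>.1 (h0 i hi)
      linarith
    -- Equality in Cauchy–Schwarz: the variance about the mean `p / N` is zero.
    · have hsum : ∑ i ∈ M, (|f i| - p / N) ^ 2 = 0 := by
        simp_rw [sub_sq, Finset.sum_add_distrib, Finset.sum_sub_distrib, Finset.sum_const,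
          nsmul_eq_mul, hM, sq_abs]
        rw [← hP, ← Finset.sum_mul, ← Finset.mul_sum, ← hp]
        field_simp
        linarith
      have h0 := (Finset.sum_eq_zero_iff_of_nonneg fun i _ => sq_nonneg (|f i| - p / N)).1 hsum
      intro i hi
      have h1 : |f i| = p / N := by
        have := pow_eq_zero_iff (two_ne_zero) |>.1 (h0 i hi)
        linarith
      rw [← sq_abs, h1, div_pow, hpN, hPD']
      field_simp
  · have hQa : Q = a ^ 2 / K := by
      rw [hQ, Finset.sum_congr rfl fun i hi => by rw [h1 i hi], Finset.sum_const, nsmul_eq_mul, hL]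
      field_simp
    have hSa : S = a := by
      rw [hS, Finset.sum_congr rfl fun i hi => by rw [h1 i hi, abs_neg, abs_of_pos (by positivity)],
        Finset.sum_const, nsmul_eq_mul, hL]
      field_simp
    have hPD' : P = D := by
      rw [hP, Finset.sum_congr rfl h2, Finset.sum_const, nsmul_eq_mul, hM]
      field_simp
    have hxa : x = a := by
      have : x ^ 2 = a ^ 2 := by rw [hPD', hD] at hT; linarith
      exact (pow_left_inj₀ hx0.le ha.le two_ne_zero).1 this
    have hpa : p = s * q := by
      have h3 : ∀ i ∈ M, |f i| = √(D / N) := fun i hi => by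
        rw [← Real.sqrt_sq_eq_abs, h2 i hi]; congr 1; ring
      rw [hp, Finset.sum_congr rfl h3, Finset.sum_const, nsmul_eq_mul, hM, Real.sqrt_div hD0]
      rw [← hs2]
      have : s ≠ 0 := by intro h; rw [h] at hs2; simp at hs2; linarith
      rw [hs2, ← hs, ← hq]
      field_simp
      rw [← hs2]; ring
    rw [hxa, hSa, hpa]; ring

/-! ### Weighted sums of a decreasing sequence -/

/-- Splitting off the first term and the last `r - 1` terms of a sum over `1, …, n`. -/
theorem Finset.sum_Icc_one_eq_add_add {n r : ℕ} (hr : 2 ≤ r) (hrn : r < n) (g : ℕ → ℝ) :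
    ∑ i ∈ Finset.Icc 1 n, g i =
      g 1 + ∑ i ∈ Finset.Icc 2 (n - r + 1), g i + ∑ i ∈ Finset.Icc (n - r + 2) n, g i := by
  have h1 : Finset.Icc 1 n = insert 1 (Finset.Icc 2 (n - r + 1) ∪ Finset.Icc (n - r + 2) n) := by
    ext i
    simp only [Finset.mem_Icc, Finset.mem_insert, Finset.mem_union]
    omega
  rw [h1, Finset.sum_insert, Finset.sum_union, add_assoc]
  · rw [Finset.disjoint_left]
    intro i
    simp only [Finset.mem_Icc]
    omega
  · simp only [Finset.mem_Icc, Finset.mem_union]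
    omega

/-- A weighted sum of a decreasing sequence with weights in `[0, 1]` bounds the sum of its
smallest entries. -/
theorem sum_smallest_le_neg_of_weights {l w : ℕ → ℝ} {n r : ℕ} (hr : 2 ≤ r) (hrn : r < n)
    (hl : AntitoneOn l (Set.Icc 1 n)) (hl0 : ∑ i ∈ Finset.Icc 1 n, l i = 0)
    (hw0 : ∀ i ∈ Finset.Icc 1 n, 0 ≤ w i) (hw1 : ∀ i ∈ Finset.Icc 1 n, w i ≤ 1) (hw : w 1 = 1)
    (hws : ∑ i ∈ Finset.Icc 1 n, w i ≤ r) (hlw : ∑ i ∈ Finset.Icc 1 n, l i * w i = 0) :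
    ∑ i ∈ Finset.Icc (n - r + 2) n, l i ≤ -l 1 := by
  rw [Finset.sum_Icc_one_eq_add_add hr hrn] at hl0 hws hlw
  set t := l (n - r + 2) with ht
  have hM : ∀ i ∈ Finset.Icc 2 (n - r + 1), t ≤ l i := by
    intro i hi
    rw [Finset.mem_Icc] at hi
    exact hl ⟨by omega, by omega⟩ ⟨by omega, by omega⟩ (by omega)
  have hL : ∀ i ∈ Finset.Icc (n - r + 2) n, l i ≤ t := by
    intro i hi
    rw [Finset.mem_Icc] at hi
    exact hl ⟨by omega, by omega⟩ ⟨by omega, by omega⟩ (by omega)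
  -- For `t ≤ 0`, compare with the threshold `t`, using that the weights after the first total at
  -- most `r - 1`. For `t > 0` the middle block is nonnegative, so the zero total suffices.
  rcases le_or_gt t 0 with h | h
  · have h1 : t * ∑ i ∈ Finset.Icc 2 (n - r + 1), w i ≤
        ∑ i ∈ Finset.Icc 2 (n - r + 1), l i * w i := by
      rw [Finset.mul_sum]
      refine Finset.sum_le_sum fun i hi => mul_le_mul_of_nonneg_right (hM i hi) (hw0 i ?_)
      rw [Finset.mem_Icc] at hi ⊢
      omega
    have h2 : t * ∑ i ∈ Finset.Icc (n - r + 2) n, w i +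
        ∑ i ∈ Finset.Icc (n - r + 2) n, (l i - t) ≤
        ∑ i ∈ Finset.Icc (n - r + 2) n, l i * w i := by
      rw [Finset.mul_sum, ← Finset.sum_add_distrib]
      refine Finset.sum_le_sum fun i hi => ?_
      have hi' : i ∈ Finset.Icc 1 n := by
        rw [Finset.mem_Icc] at hi ⊢
        omega
      nlinarith [hL i hi, hw1 i hi']
    have hcard : (((Finset.Icc (n - r + 2) n).card : ℕ) : ℝ) = (r : ℝ) - 1 := by
      rw [Nat.card_Icc, show n + 1 - (n - r + 2) = r - 1 by omega, Nat.cast_sub (by omega)]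
      simp
    rw [Finset.sum_sub_distrib, Finset.sum_const, nsmul_eq_mul, hcard] at h2
    rw [hw] at hws hlw
    have h3 : t * ((r : ℝ) - 1) ≤ t * (∑ i ∈ Finset.Icc 2 (n - r + 1), w i +
        ∑ i ∈ Finset.Icc (n - r + 2) n, w i) :=
      mul_le_mul_of_nonpos_left (by linarith) h
    linarith
  · have : 0 ≤ ∑ i ∈ Finset.Icc 2 (n - r + 1), l i :=
      Finset.sum_nonneg fun i hi => h.le.trans (hM i hi)
    linarith

/-! ### Spectral identities for real Hermitian matrices -/

namespace Matrix

/-- The square of a Hermitian matrix has the squared eigenvalues. -/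
theorem IsHermitian.roots_charpoly_mul_self {n : Type*} [Fintype n] [DecidableEq n]
    {A : Matrix n n ℝ} (hA : A.IsHermitian) :
    (A * A).charpoly.roots = Finset.univ.val.map fun i => hA.eigenvalues₀ i ^ 2 := by
  have hsq : A * A = Unitary.conjStarAlgAut ℝ _ hA.eigenvectorUnitary
      (diagonal fun i => hA.eigenvalues i ^ 2) := by
    conv_lhs => rw [hA.spectral_theorem, ← map_mul, diagonal_mul_diagonal]
    simp [sq]
  have hchar : (A * A).charpoly =
      ∏ i, (Polynomial.X - Polynomial.C (hA.eigenvalues i ^ 2)) := by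
    rw [hsq, Unitary.conjStarAlgAut_apply, charpoly_mul_comm, ← mul_assoc]
    simp [charpoly_diagonal]
  have hroots : (A * A).charpoly.roots =
      Finset.univ.val.map fun i => hA.eigenvalues i ^ 2 := by
    rw [hchar, Polynomial.roots_prod]
    · simp [-map_pow]
    · simp [-map_pow, Finset.prod_ne_zero_iff, Polynomial.X_sub_C_ne_zero]
  -- The two enumerations have different index types, so they are compared as multisets of roots.
  have h := hA.roots_charpoly_eq_eigenvalues.symm.trans hA.roots_charpoly_eq_eigenvalues₀
  have h2 := congrArg (Multiset.map fun x : ℝ => x ^ 2) h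
  rw [Multiset.map_map, Multiset.map_map] at h2
  rw [hroots]
  exact h2

/-- The trace norm of a real Hermitian matrix is the sum of the absolute values of its
eigenvalues. -/
theorem IsHermitian.traceNorm_eq_sum_abs {n : Type*} [Fintype n] [DecidableEq n]
    {A : Matrix n n ℝ} (hA : A.IsHermitian) :
    A.traceNorm = ∑ i, |hA.eigenvalues₀ i| := by
  set T := toEuclideanLin A with hT
  have hTT : LinearMap.adjoint T ∘ₗ T = toEuclideanLin (A * A) := by
    rw [hT, ← toEuclideanLin_conjTranspose_eq_adjoint, hA.eq]
    ext x i
    simp [toLpLin_apply]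
  have hchar : (LinearMap.adjoint T ∘ₗ T).charpoly = (A * A).charpoly := by
    rw [hTT, toEuclideanLin_eq_toLin_orthonormal, charpoly_toLin]
  have hroots := T.isSymmetric_adjoint_comp_self.roots_charpoly_eq_eigenvalues
    (finrank_euclideanSpace (𝕜 := ℝ) (ι := n))
  rw [hchar, hA.roots_charpoly_mul_self] at hroots
  have hsum := congrArg (fun s => (Multiset.map Real.sqrt s).sum) hroots
  simp only [Multiset.map_map, Function.comp_def, Real.sqrt_sq_eq_abs] at hsum
  rw [Matrix.traceNorm, Finset.sum_range]
  simp_rw [← hT, T.singularValues_fin finrank_euclideanSpace]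
  exact hsum.symm

theorem IsHermitian.trace_mul_self_eq_sum_sq {n : Type*} [Fintype n] [DecidableEq n]
    {A : Matrix n n ℝ} (hA : A.IsHermitian) :
    (A * A).trace = ∑ i, hA.eigenvalues₀ i ^ 2 := by
  have hAA : (A * A).IsHermitian := by
    rw [IsHermitian, conjTranspose_mul, hA.eq]
  rw [trace_eq_sum_roots_charpoly_of_splits hAA.splits_charpoly, hA.roots_charpoly_mul_self]
  rfl

theorem IsHermitian.trace_eq_sum_eigenvalues₀ {n : Type*} [Fintype n] [DecidableEq n]
    {A : Matrix n n ℝ} (hA : A.IsHermitian) :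
    A.trace = ∑ i, hA.eigenvalues₀ i := by
  rw [trace_eq_sum_roots_charpoly_of_splits hA.splits_charpoly, hA.roots_charpoly_eq_eigenvalues₀]
  rfl

/-- A real Hermitian matrix has an orthonormal basis of eigenvectors, ordered by decreasing
eigenvalues. -/
theorem IsHermitian.exists_orthonormalBasis_inner_toEuclideanLin {n : Type*} [Fintype n]
    [DecidableEq n] {A : Matrix n n ℝ} (hA : A.IsHermitian) :
    ∃ b : OrthonormalBasis (Fin (Fintype.card n)) ℝ (EuclideanSpace ℝ n), ∀ i y,
      ⟪b i, toEuclideanLin A y⟫_ℝ = hA.eigenvalues₀ i * ⟪b i, y⟫_ℝ := by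
  have hs := isSymmetric_toEuclideanLin_iff.mpr hA
  refine ⟨hs.eigenvectorBasis finrank_euclideanSpace, fun i y => ?_⟩
  rw [← hs, hs.apply_eigenvectorBasis finrank_euclideanSpace, inner_smul_left]
  rfl

end Matrix

/-! ### Adjacency eigenvalues indexed from `1` -/

namespace SimpleGraph

variable {V : Type*} [Fintype V] [DecidableEq V] (G : SimpleGraph V) [DecidableRel G.Adj]

theorem adjEigenvalue_succ (i : Fin (Fintype.card V)) :
    G.adjEigenvalue (i + 1) = (G.isHermitian_adjMatrix ℝ).eigenvalues₀ i := by
  rw [adjEigenvalue, dif_pos ⟨by omega, by omega⟩]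
  rfl

theorem antitoneOn_adjEigenvalue :
    AntitoneOn G.adjEigenvalue (Set.Icc 1 (Fintype.card V)) := by
  intro i hi j hj hij
  rw [adjEigenvalue, adjEigenvalue, dif_pos (Set.mem_Icc.1 hi), dif_pos (Set.mem_Icc.1 hj)]
  exact (G.isHermitian_adjMatrix ℝ).eigenvalues₀_antitone (Fin.mk_le_mk.2 (by omega))

theorem _root_.Finset.sum_Icc_one_eq_sum_fin (N : ℕ) (g : ℕ → ℝ) :
    ∑ i ∈ Finset.Icc 1 N, g i = ∑ i : Fin N, g (i + 1) := by
  rw [← Finset.sum_range (fun i => g (i + 1)), Finset.range_eq_Ico,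
    Finset.sum_Ico_add' g 0 N 1]
  rfl

theorem traceNorm_eq_sum_abs_adjEigenvalue :
    G.traceNorm = ∑ i ∈ Finset.Icc 1 (Fintype.card V), |G.adjEigenvalue i| := by
  rw [Finset.sum_Icc_one_eq_sum_fin, traceNorm,
    (G.isHermitian_adjMatrix ℝ).traceNorm_eq_sum_abs]
  simp_rw [adjEigenvalue_succ]

theorem sum_adjEigenvalue : ∑ i ∈ Finset.Icc 1 (Fintype.card V), G.adjEigenvalue i = 0 := by
  rw [Finset.sum_Icc_one_eq_sum_fin]
  simp_rw [adjEigenvalue_succ]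
  rw [← (G.isHermitian_adjMatrix ℝ).trace_eq_sum_eigenvalues₀, trace_adjMatrix]

theorem sum_sq_adjEigenvalue :
    ∑ i ∈ Finset.Icc 1 (Fintype.card V), G.adjEigenvalue i ^ 2 = 2 * (G.edgeFinset.card : ℝ) := by
  rw [Finset.sum_Icc_one_eq_sum_fin]
  simp_rw [adjEigenvalue_succ]
  rw [← (G.isHermitian_adjMatrix ℝ).trace_mul_self_eq_sum_sq, Matrix.trace]
  simp_rw [Matrix.diag_apply, adjMatrix_mul_self_apply_self]
  exact_mod_cast G.sum_degrees_eq_twice_card_edges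

/-- There is an orthonormal basis of eigenvectors, enumerated in the order of the eigenvalues. -/
theorem exists_eigenvectors : ∃ b : ℕ → EuclideanSpace ℝ V,
    (∀ i ∈ Finset.Icc 1 (Fintype.card V), ‖b i‖ = 1) ∧
    (∀ x y, ∑ i ∈ Finset.Icc 1 (Fintype.card V), ⟪x, b i⟫_ℝ * ⟪b i, y⟫_ℝ = ⟪x, y⟫_ℝ) ∧
    (∀ i ∈ Finset.Icc 1 (Fintype.card V), ∀ y,
      ⟪b i, Matrix.toEuclideanLin (G.adjMatrix ℝ) y⟫_ℝ = G.adjEigenvalue i * ⟪b i, y⟫_ℝ) := by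
  obtain ⟨b, hb⟩ :=
    (G.isHermitian_adjMatrix ℝ).exists_orthonormalBasis_inner_toEuclideanLin
  refine ⟨fun i => if h : 1 ≤ i ∧ i ≤ Fintype.card V then b ⟨i - 1, by omega⟩ else 0, ?_, ?_, ?_⟩
  · intro i hi
    simp only [dif_pos (Finset.mem_Icc.1 hi)]
    exact b.orthonormal.1 _
  · intro x y
    rw [Finset.sum_Icc_one_eq_sum_fin, ← b.sum_inner_mul_inner x y]
    refine Finset.sum_congr rfl fun i _ => ?_
    have hi : 1 ≤ (i : ℕ) + 1 ∧ (i : ℕ) + 1 ≤ Fintype.card V := ⟨by omega, by omega⟩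
    simp only [dif_pos hi]
    rfl
  · intro i hi y
    simp only [adjEigenvalue, dif_pos (Finset.mem_Icc.1 hi), hb]

end SimpleGraph

/-! ### Hoffman's inequality and the average degree bound -/

namespace SimpleGraph

variable {V : Type*} [Fintype V] [DecidableEq V] (G : SimpleGraph V) [DecidableRel G.Adj]

/-- Hoffman's inequality: in an `r`-partite graph on `n > r` vertices, the `r - 1` smallest
eigenvalues sum to at most `-λ₁`. -/
theorem sum_smallest_adjEigenvalue_le {r : ℕ} (hr : 2 ≤ r) (hrn : r < Fintype.card V)
    (hG : G.Colorable r) :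
    ∑ i ∈ Finset.Icc (Fintype.card V - r + 2) (Fintype.card V), G.adjEigenvalue i ≤
      -G.adjEigenvalue 1 := by
  obtain ⟨C⟩ := hG
  obtain ⟨b, hb1, hbP, hbT⟩ := G.exists_eigenvectors
  set N := Fintype.card V with hN
  have h1N : 1 ∈ Finset.Icc 1 N := Finset.mem_Icc.2 ⟨le_rfl, by omega⟩
  set y : Fin r → EuclideanSpace ℝ V :=
    fun c => WithLp.toLp 2 fun v => if C v = c then b 1 v else 0 with hy
  -- `s c` may be `0`; division by zero then drops that class, so the weights below total at most
  -- `r`.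
  set s : Fin r → ℝ := fun c => ∑ v, if C v = c then b 1 v ^ 2 else 0 with hs
  have hs0 : ∀ c, 0 ≤ s c := fun c => Finset.sum_nonneg fun v _ => by split_ifs <;> positivity
  have norm_sum : ∀ z : EuclideanSpace ℝ V,
      ∑ c, ∑ v, (if C v = c then z v ^ 2 else 0) = ‖z‖ ^ 2 := by
    intro z
    rw [Finset.sum_comm, EuclideanSpace.real_norm_sq_eq]
    simp
  have hyy : ∀ c, ⟪y c, y c⟫_ℝ = s c := by
    intro c
    simp only [PiLp.inner_apply, hy, hs]
    refine Finset.sum_congr rfl fun v _ => ?_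
    split_ifs <;> simp [sq]
  have hyb : ∀ c i, ⟪y c, b i⟫_ℝ = ∑ v, (if C v = c then b 1 v else 0) *
      (if C v = c then b i v else 0) := by
    intro c i
    simp only [PiLp.inner_apply, hy]
    refine Finset.sum_congr rfl fun v _ => ?_
    split_ifs <;> simp [mul_comm]
  have hyb1 : ∀ c, ⟪y c, b 1⟫_ℝ = s c := by
    intro c
    rw [hyb]
    refine Finset.sum_congr rfl fun v _ => ?_
    split_ifs <;> simp [sq]
  have hCS : ∀ c i, ⟪y c, b i⟫_ℝ ^ 2 ≤ s c * ∑ v, if C v = c then b i v ^ 2 else 0 := by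
    intro c i
    rw [hyb]
    refine (Finset.sum_mul_sq_le_sq_mul_sq _ _ _).trans_eq ?_
    simp only [hs, ite_pow, zero_pow two_ne_zero]
  have hyT : ∀ c, ⟪y c, Matrix.toEuclideanLin (G.adjMatrix ℝ) (y c)⟫_ℝ = 0 := by
    intro c
    simp only [PiLp.inner_apply, Matrix.toLpLin_apply, adjMatrix_mulVec_apply, hy]
    refine Finset.sum_eq_zero fun v _ => ?_
    split_ifs with hv
    · rw [Finset.sum_eq_zero, inner_zero_right]
      intro u hu
      rw [mem_neighborFinset] at hu
      rw [if_neg]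
      rw [← hv]
      exact (C.valid hu).symm
    · simp
  -- The weights are the diagonal entries, in the eigenbasis, of the projection onto the span of the
  -- pieces `y c` of `b 1`. Colour classes are independent, so the eigenvalues have weighted sum
  -- zero.
  refine sum_smallest_le_neg_of_weights hr hrn G.antitoneOn_adjEigenvalue G.sum_adjEigenvalue
    (w := fun i => ∑ c, ⟪y c, b i⟫_ℝ ^ 2 / s c)
    (fun i _ => Finset.sum_nonneg fun c _ => div_nonneg (sq_nonneg _) (hs0 c)) ?_ ?_ ?_ ?_
  · intro i hi
    calc ∑ c, ⟪y c, b i⟫_ℝ ^ 2 / s c ≤ ∑ c, ∑ v, (if C v = c then b i v ^ 2 else 0) := by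
          refine Finset.sum_le_sum fun c _ => div_le_of_le_mul₀ (hs0 c) ?_ ?_
          · exact Finset.sum_nonneg fun v _ => by split_ifs <;> positivity
          · rw [mul_comm]; exact hCS c i
      _ = 1 := by rw [norm_sum, hb1 i hi, one_pow]
  · calc ∑ c, ⟪y c, b 1⟫_ℝ ^ 2 / s c = ∑ c, s c := by
          refine Finset.sum_congr rfl fun c _ => ?_
          rw [hyb1, sq, mul_self_div_self]
      _ = 1 := by rw [norm_sum, hb1 1 h1N, one_pow]
  · rw [Finset.sum_comm]
    calc ∑ c, ∑ i ∈ Finset.Icc 1 N, ⟪y c, b i⟫_ℝ ^ 2 / s c ≤ ∑ _c : Fin r, (1 : ℝ) := by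
          refine Finset.sum_le_sum fun c _ => ?_
          rw [← Finset.sum_div]
          have : ∑ i ∈ Finset.Icc 1 N, ⟪y c, b i⟫_ℝ ^ 2 = s c := by
            rw [← hyy, ← hbP]
            exact Finset.sum_congr rfl fun i _ => by rw [sq, real_inner_comm (b i) (y c)]
          rw [this]
          exact div_self_le_one _
      _ = r := by simp
  · simp_rw [Finset.mul_sum]
    rw [Finset.sum_comm]
    refine Finset.sum_eq_zero fun c _ => ?_
    calc ∑ i ∈ Finset.Icc 1 N, G.adjEigenvalue i * (⟪y c, b i⟫_ℝ ^ 2 / s c)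
        = (∑ i ∈ Finset.Icc 1 N, ⟪y c, b i⟫_ℝ *
            ⟪b i, Matrix.toEuclideanLin (G.adjMatrix ℝ) (y c)⟫_ℝ) / s c := by
          rw [Finset.sum_div]
          refine Finset.sum_congr rfl fun i hi => ?_
          rw [hbT i hi, real_inner_comm (y c) (b i)]
          ring
      _ = 0 := by rw [hbP, hyT, zero_div]

/-- The largest adjacency eigenvalue is at least the average degree, with equality only for
regular graphs. -/
theorem average_degree_le_adjEigenvalue_one [Nonempty V] :
    2 * (G.edgeFinset.card : ℝ) / Fintype.card V ≤ G.adjEigenvalue 1 ∧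
    (G.adjEigenvalue 1 = 2 * (G.edgeFinset.card : ℝ) / Fintype.card V →
      ∃ d : ℕ, G.IsRegularOfDegree d) := by
  obtain ⟨b, -, hbP, hbT⟩ := G.exists_eigenvectors
  have hN0 : 0 < Fintype.card V := Fintype.card_pos
  set N := Fintype.card V with hN
  set l := G.adjEigenvalue 1 with hl
  set T := Matrix.toEuclideanLin (G.adjMatrix ℝ) with hT
  set u : EuclideanSpace ℝ V := WithLp.toLp 2 fun _ => 1 with hu
  have hTu : ∀ v, T u v = G.degree v := by
    intro v
    simp [hT, hu, Matrix.toLpLin_apply, adjMatrix_mulVec_apply]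
  have huu : ⟪u, u⟫_ℝ = N := by
    rw [real_inner_self_eq_norm_sq, EuclideanSpace.real_norm_sq_eq]
    simp [hu, hN]
  have huT : ⟪u, T u⟫_ℝ = 2 * (G.edgeFinset.card : ℝ) := by
    simp only [PiLp.inner_apply, hTu]
    simp only [hu, RCLike.inner_apply, conj_trivial, mul_one]
    exact_mod_cast G.sum_degrees_eq_twice_card_edges
  have hle : ∀ i ∈ Finset.Icc 1 N, G.adjEigenvalue i ≤ l := by
    intro i hi
    rw [Finset.mem_Icc] at hi
    exact G.antitoneOn_adjEigenvalue ⟨le_rfl, hN0⟩ ⟨hi.1, hi.2⟩ hi.1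
  have hnonneg : ∀ i ∈ Finset.Icc 1 N, 0 ≤ (l - G.adjEigenvalue i) * ⟪b i, u⟫_ℝ ^ 2 :=
    fun i hi => mul_nonneg (sub_nonneg.2 (hle i hi)) (sq_nonneg _)
  have hsum : ∑ i ∈ Finset.Icc 1 N, (l - G.adjEigenvalue i) * ⟪b i, u⟫_ℝ ^ 2 =
      l * N - 2 * (G.edgeFinset.card : ℝ) := by
    rw [← huu, ← huT, ← hbP u u, ← hbP u (T u), Finset.mul_sum, ← Finset.sum_sub_distrib]
    refine Finset.sum_congr rfl fun i hi => ?_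
    rw [hbT i hi, real_inner_comm (b i) u]
    ring
  have hNr : (0 : ℝ) < N := by exact_mod_cast hN0
  constructor
  · rw [div_le_iff₀ hNr]
    linarith [Finset.sum_nonneg hnonneg]
  · intro heq
    rw [eq_div_iff hNr.ne'] at heq
    rw [heq, sub_self, Finset.sum_eq_zero_iff_of_nonneg hnonneg] at hsum
    -- In the equality case `u` has components only at eigenvalue `l`, so it is an eigenvector and
    -- every degree is `l`.
    have hz : T u - l • u = 0 := by
      rw [← inner_self_eq_zero (𝕜 := ℝ), ← hbP]
      refine Finset.sum_eq_zero fun i hi => ?_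
      have : ⟪b i, T u - l • u⟫_ℝ = 0 := by
        rw [inner_sub_right, hbT i hi, inner_smul_right, ← sub_mul]
        have := hsum i hi
        rcases mul_eq_zero.1 this with h | h
        · rw [← neg_sub, h]; simp
        · rw [pow_eq_zero_iff two_ne_zero] at h
          rw [h, mul_zero]
      rw [this, mul_zero]
    have hdeg : ∀ v, (G.degree v : ℝ) = l := by
      intro v
      have := congrArg (fun z : EuclideanSpace ℝ V => z v) hz
      simp only [PiLp.sub_apply, PiLp.smul_apply, hTu] at this
      simp [hu] at this
      linarith
    obtain ⟨v₀⟩ := ‹Nonempty V›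
    refine ⟨G.degree v₀, fun v => ?_⟩
    exact_mod_cast (hdeg v).trans (hdeg v₀).symm

end SimpleGraph

/-! ### The theorem -/

theorem mainTheorem6 {V : Type*} [Fintype V] [DecidableEq V] (G : SimpleGraph V)
    [DecidableRel G.Adj] (n m r : ℕ) (hr : 2 < r) (hrn : r < n)
    (hn : Fintype.card V = n) (hm : G.edgeFinset.card = m)
    (hmn : r ^ 2 * n ≤ 2 * m) (hG : G.Partitionable r) :
    G.traceNorm ≤ 4 * (m : ℝ) / n +
        √(((n : ℝ) - r) * (2 * m - (r : ℝ) / (r - 1) * (2 * m / n) ^ 2)) ∧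
    (G.traceNorm = 4 * (m : ℝ) / n +
        √(((n : ℝ) - r) * (2 * m - (r : ℝ) / (r - 1) * (2 * m / n) ^ 2)) ↔
      (∃ d : ℕ, G.IsRegularOfDegree d) ∧
      (∀ i ∈ Finset.Icc (n - r + 2) n,
        G.adjEigenvalue i = -(2 * (m : ℝ) / (((r : ℝ) - 1) * n))) ∧
      (∀ i ∈ Finset.Icc 2 (n - r + 1),
        G.adjEigenvalue i ^ 2 =
          1 / ((n : ℝ) - r) * (2 * m - (r : ℝ) / (r - 1) * (2 * m / n) ^ 2))) := by
  have : Nonempty V := Fintype.card_pos_iff.1 (by omega)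
  obtain ⟨havg, hreg⟩ := G.average_degree_le_adjEigenvalue_one
  have hsmall := G.sum_smallest_adjEigenvalue_le hr.le (hn ▸ hrn)
    (SimpleGraph.partitionable_iff_colorable.1 hG)
  have hsq := G.sum_sq_adjEigenvalue
  have htr := G.traceNorm_eq_sum_abs_adjEigenvalue
  rw [hn] at havg hreg hsmall hsq htr
  rw [hm] at havg hreg hsq
  rw [Finset.sum_Icc_one_eq_add_add hr.le hrn] at hsq htr
  have hrR : (2 : ℝ) < r := by exact_mod_cast hr
  have hrnR : (r : ℝ) < n := by exact_mod_cast hrn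
  have hmnR : (r : ℝ) ^ 2 * n ≤ 2 * m := by exact_mod_cast hmn
  have hn0 : (0 : ℝ) < n := by linarith
  set a : ℝ := 2 * m / n with ha
  have ham : a * n = 2 * m := div_mul_cancel₀ _ hn0.ne'
  have har : (r : ℝ) ^ 2 ≤ a := by rwa [ha, le_div_iff₀ hn0]
  have ha0 : 0 < a := lt_of_lt_of_le (by positivity) har
  have hK0 : (0 : ℝ) < r - 1 := by linarith
  -- Dividing by `a` leaves `(r - 1)² n < a (n + r² - 2r)`, which follows from `a ≥ r²`.
  have hlt : ((r : ℝ) - 1) ^ 2 * (2 * m - ((r : ℝ) - 1 + 1) / (r - 1) * a ^ 2) <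
      (n - r) * a ^ 2 := by
    have h1 : ((r : ℝ) - 1) ^ 2 * (2 * m - ((r : ℝ) - 1 + 1) / (r - 1) * a ^ 2) =
        a * ((r - 1) ^ 2 * n - r * (r - 1) * a) := by
      rw [← ham]; field_simp; ring
    rw [h1, show ((n : ℝ) - r) * a ^ 2 = a * ((n - r) * a) by ring]
    refine mul_lt_mul_of_pos_left ?_ ha0
    have h2 : (r : ℝ) ^ 2 * (n + r ^ 2 - 2 * r) ≤ a * (n + r ^ 2 - 2 * r) :=
      mul_le_mul_of_nonneg_right har (by nlinarith)
    have h3 : ((r : ℝ) - 1) ^ 2 * n < r ^ 2 * n := mul_lt_mul_of_pos_right (by nlinarith) hn0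
    have h4 : 0 ≤ (r : ℝ) ^ 2 * (r ^ 2 - 2 * r) := mul_nonneg (sq_nonneg _) (by nlinarith)
    linarith
  have hcM : ((Finset.Icc 2 (n - r + 1)).card : ℝ) = n - r := by
    rw [Nat.card_Icc, show n - r + 1 + 1 - 2 = n - r by omega, Nat.cast_sub hrn.le]
  have hcL : ((Finset.Icc (n - r + 2) n).card : ℝ) = r - 1 := by
    rw [Nat.card_Icc, show n + 1 - (n - r + 2) = r - 1 by omega, Nat.cast_sub (by omega),
      Nat.cast_one]
  have hopt := l1_le_and_eq_iff_of_sum_sq hcM hcL (by linarith) (by linarith) ha0 havg hsmall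
    hsq hlt
  rw [← htr, sub_add_cancel] at hopt
  have h4 : 4 * (m : ℝ) / n = 2 * a := by rw [ha]; ring
  have hdiv : 2 * (m : ℝ) / (((r : ℝ) - 1) * n) = a / (r - 1) := by
    rw [ha, div_div, mul_comm ((r : ℝ) - 1)]
  rw [h4, hdiv]
  exact ⟨hopt.1, fun h => ⟨hreg (hopt.2.1 h), hopt.2.2.1 h⟩, fun h => hopt.2.2.2 h.2⟩
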